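/- For a finite connected graph $G$ with shortest-path distance $d_G$, a set $S \subseteq V(G)$ is a general position set if $d_G(u,v) \neq d_G(u,w) + d_G(w,v)$ for all pairwise distinct $u,v,w \in S$ (equivalently, no three vertices of $S$ lie on a common geodesic). The general position number $\mathrm{gp}(G)$ is the largest cardinality of a general position set of $G$. Let $P_r$ be the path on $r$ vertices, $C_s$ the cycle on $s$ vertices, and $\square$ the Cartesian product of graphs. **Theorem.** If $r \ge 2$ and $s \ge 3$, then $$ \mathrm{gp}(P_r \,\square\, C_s) = \begin{cases} 3, & r = 2 \text{ and } s = 3,\\ 5, & r \ge 5 \text{ and } (s = 7 \text{ or } s \ge 9),\\ 4, & \text{otherwise.}\end{cases} $$ -/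

import Mathlib

/-- A set `S` of vertices of a connected graph `G` is a general position set if
`d(u,v) ≠ d(u,w) + d(w,v)` for every labelling `u, v, w` of three distinct vertices of `S`. -/
def SimpleGraph.IsGeneralPosition {V : Type*} (G : SimpleGraph V) (S : Set V) : Prop :=
  ∀ ⦃u⦄, u ∈ S → ∀ ⦃v⦄, v ∈ S → ∀ ⦃w⦄, w ∈ S → u ≠ v → u ≠ w → v ≠ w →
    G.dist u v ≠ G.dist u w + G.dist w v

open Classical in
/-- The general position number of a finite connected graph: the largest cardinality of a
general position set. -/
noncomputable def SimpleGraph.gpNumber {V : Type*} [Fintype V] (G : SimpleGraph V) : ℕ :=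
  (Finset.univ.filter fun S : Finset V => G.IsGeneralPosition (S : Set V)).sup Finset.card

/-- The cylinder graph `P_r □ C_s`. -/
def cylinderGraph (r s : ℕ) : SimpleGraph (Fin r × Fin s) :=
  SimpleGraph.boxProd (SimpleGraph.pathGraph r) (SimpleGraph.cycleGraph s)

/-! Distances on the cylinder add over the two factors. So if three points are listed by path
coordinate, the middle one is on a geodesic between the outer two exactly when its residue is on a
shortest arc between theirs. Only the order of the path coordinates, with its ties, and the residues
matter.

Six points are too many: rotate the first residue to 0; three of the other five lie in one half of
the cycle, where comparing distances to 0 gives a forbidden triple (`not_noCycMonotone_six`). Five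
points cannot have two equal path coordinates, since a tie allows both orders and overconstrains the
other three points (`ne_of_tie`); hence five points need `5 ≤ r`. For `s ≤ 6` or `s = 8`, a finite
check excludes five residues. Explicit configurations give the lower bounds. -/

/-- The distance between the residues `a, b < s` around a cycle of length `s`. -/
def cycDist (s a b : ℕ) : ℕ := min (Nat.dist a b) (s - Nat.dist a b)

/-- The residue `b` lies on a shortest arc from `a` to `c` in the cycle of length `s`. -/
abbrev CycBetween (s a b c : ℕ) : Prop := cycDist s a c = cycDist s a b + cycDist s b c

theorem cycDist_comm (s a b : ℕ) : cycDist s a b = cycDist s b a := by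
  simp only [cycDist, Nat.dist_comm]

/-! ### Distances in paths, cycles and cylinders -/

namespace SimpleGraph

/-- The Lipschitz bound makes every walk long enough; descending steps build a walk of length
exactly `D u v`. -/
theorem dist_eq_of_adj_step {V : Type*} {G : SimpleGraph V} {D : V → V → ℕ}
    (zero : ∀ u, D u u = 0) (lip : ∀ u v w, G.Adj v w → D u w ≤ D u v + 1)
    (step : ∀ u v, u ≠ v → ∃ w, G.Adj w v ∧ D u w + 1 = D u v) (u v : V) :
    G.Reachable u v ∧ G.dist u v = D u v := by
  have lower : ∀ {a b : V} (p : G.Walk a b) (u : V), D u b ≤ D u a + p.length := by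
    intro a b p
    induction p with
    | nil => simp
    | cons h p ih =>
      intro u
      have h₁ := ih u
      have h₂ := lip u _ _ h
      rw [Walk.length_cons]
      omega
  have upper : ∀ n (u v : V), D u v = n → ∃ p : G.Walk u v, p.length = n := by
    intro n
    induction n with
    | zero =>
      intro u v h
      by_cases huv : u = v
      · subst huv
        exact ⟨.nil, rfl⟩
      · obtain ⟨w, -, hw⟩ := step u v huv
        omega
    | succ n ih =>
      intro u v h
      have huv : u ≠ v := by
        rintro rfl
        rw [zero] at h
        omega
      obtain ⟨w, hwv, hw⟩ := step u v huv
      obtain ⟨p, hp⟩ := ih u w (by omega)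
      exact ⟨p.concat hwv, by simp [hp]⟩
  obtain ⟨p, hp⟩ := upper _ u v rfl
  refine ⟨p.reachable, le_antisymm (hp ▸ dist_le p) ?_⟩
  obtain ⟨q, hq⟩ := p.reachable.exists_walk_length_eq_dist
  have := lower q u
  rw [zero, hq] at this
  omega

theorem reachable_and_dist_pathGraph {n : ℕ} (u v : Fin n) :
    (pathGraph n).Reachable u v ∧ (pathGraph n).dist u v = Nat.dist u v := by
  refine dist_eq_of_adj_step (D := fun u v : Fin n => Nat.dist u v) (by simp) ?_ ?_ u v
  · intro u v w h
    rw [pathGraph_adj] at h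
    simp only [Nat.dist]
    omega
  · intro u v huv
    have huv' : (u : ℕ) ≠ v := fun h => huv (Fin.ext h)
    rcases lt_or_gt_of_ne huv' with h | h
    · refine ⟨⟨v - 1, by omega⟩, ?_, ?_⟩
      · rw [pathGraph_adj]
        simp only
        omega
      · simp only [Nat.dist]
        omega
    · refine ⟨⟨v + 1, by omega⟩, ?_, ?_⟩
      · exact pathGraph_adj.2 (Or.inr rfl)
      · simp only [Nat.dist]
        omega

theorem cycleGraph_adj_iff_val {n : ℕ} (hn : 2 ≤ n) {u v : Fin n} :
    (cycleGraph n).Adj u v ↔ (u : ℕ) = v + 1 ∨ (v : ℕ) = u + 1 ∨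
      ((u : ℕ) = 0 ∧ (v : ℕ) + 1 = n) ∨ ((v : ℕ) = 0 ∧ (u : ℕ) + 1 = n) := by
  rw [cycleGraph_adj', Fin.val_sub, Fin.val_sub]
  have hu := u.isLt
  have hv := v.isLt
  have key : ∀ a b : ℕ, a < n → b < n →
      ((n - b + a) % n = 1 ↔ a = b + 1 ∨ (a = 0 ∧ b + 1 = n)) := by
    intro a b ha hb
    by_cases hab : b ≤ a
    · rw [show n - b + a = (a - b) + n by omega, Nat.add_mod_right, Nat.mod_eq_of_lt (by omega)]
      omega
    · rw [Nat.mod_eq_of_lt (by omega)]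
      omega
  rw [key _ _ hu hv, key _ _ hv hu]
  tauto

theorem exists_cycDist_add_one {n u v : ℕ} (hu : u < n) (hv : v < n) (huv : u ≠ v) :
    ∃ w < n, (w = v + 1 ∨ v = w + 1 ∨ (w = 0 ∧ v + 1 = n) ∨ (v = 0 ∧ w + 1 = n)) ∧
      cycDist n u w + 1 = cycDist n u v := by
  simp only [cycDist, Nat.dist]
  by_cases h : (u < v ∧ 2 * (v - u) ≤ n) ∨ (v < u ∧ n ≤ 2 * (u - v))
  · by_cases hv0 : v = 0
    · exact ⟨n - 1, by omega, by omega, by omega⟩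
    · exact ⟨v - 1, by omega, by omega, by omega⟩
  · by_cases hvn : v + 1 = n
    · exact ⟨0, by omega, by omega, by omega⟩
    · exact ⟨v + 1, by omega, by omega, by omega⟩

theorem reachable_and_dist_cycleGraph {n : ℕ} (hn : 2 ≤ n) (u v : Fin n) :
    (cycleGraph n).Reachable u v ∧ (cycleGraph n).dist u v = cycDist n u v := by
  refine dist_eq_of_adj_step (D := fun u v : Fin n => cycDist n u v)
    (by simp [cycDist]) ?_ ?_ u v
  · intro u v w h
    rw [cycleGraph_adj_iff_val hn] at h
    simp only [cycDist, Nat.dist]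
    omega
  · intro u v huv
    obtain ⟨w, hw, hadj, hd⟩ :=
      exists_cycDist_add_one u.isLt v.isLt fun h => huv (Fin.ext h)
    exact ⟨⟨w, hw⟩, (cycleGraph_adj_iff_val hn).2 hadj, hd⟩

end SimpleGraph

theorem cylinderGraph_dist {r s : ℕ} (hs : 2 ≤ s) (u v : Fin r × Fin s) :
    (cylinderGraph r s).dist u v = Nat.dist u.1 v.1 + cycDist s u.2 v.2 := by
  obtain ⟨h₁, d₁⟩ := SimpleGraph.reachable_and_dist_pathGraph u.1 v.1
  obtain ⟨h₂, d₂⟩ := SimpleGraph.reachable_and_dist_cycleGraph hs u.2 v.2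
  have e : ((cylinderGraph r s).edist u v).toNat =
      ((SimpleGraph.pathGraph r).edist u.1 v.1 + (SimpleGraph.cycleGraph s).edist u.2 v.2).toNat :=
    congrArg ENat.toNat (SimpleGraph.edist_boxProd u v)
  rw [ENat.toNat_add (SimpleGraph.edist_ne_top_iff_reachable.2 h₁)
    (SimpleGraph.edist_ne_top_iff_reachable.2 h₂)] at e
  rw [← d₁, ← d₂]
  exact e

/-! ### Residue sequences without a forbidden triple -/

/-- No entry of the sequence `y` lies on a shortest arc of the cycle of length `s` from an earlier
entry to a later one. -/
def NoCycMonotone (s : ℕ) {n : ℕ} (y : Fin n → ℕ) : Prop :=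
  ∀ i j k : Fin n, i < j → j < k → ¬ CycBetween s (y i) (y j) (y k)

/-- Rotation of the cycle of length `s` that moves `a` to `0`. -/
def cycShift (s a b : ℕ) : ℕ := if a ≤ b then b - a else b + s - a

theorem cycShift_lt {s a b : ℕ} (ha : a < s) (hb : b < s) : cycShift s a b < s := by
  unfold cycShift
  split_ifs <;> omega

theorem cycShift_self (s a : ℕ) : cycShift s a a = 0 := by simp [cycShift]

theorem cycDist_cycShift {s a b c : ℕ} (ha : a < s) (hb : b < s) (hc : c < s) :
    cycDist s (cycShift s a b) (cycShift s a c) = cycDist s b c := by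
  simp only [cycDist, Nat.dist, cycShift]
  split_ifs <;> omega

theorem NoCycMonotone.cycShift {s n a : ℕ} {y : Fin n → ℕ} (h : NoCycMonotone s y) (ha : a < s)
    (hy : ∀ i, y i < s) : NoCycMonotone s fun i => cycShift s a (y i) := by
  intro i j k hij hjk
  simp only [CycBetween, cycDist_cycShift, ha, hy]
  exact h i j k hij hjk

theorem cycDist_zero_of_le {s a : ℕ} (h : 2 * a ≤ s) : cycDist s 0 a = a := by
  simp only [cycDist, Nat.dist]
  omega

theorem cycDist_zero_of_ge {s a : ℕ} (h : s ≤ 2 * a) : cycDist s 0 a = s - a := by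
  simp only [cycDist, Nat.dist]
  omega

theorem cycDist_of_two_mul_le {s a b : ℕ} (h : 2 * Nat.dist a b ≤ s) :
    cycDist s a b = Nat.dist a b := by
  simp only [cycDist]
  omega

/-- On one half, arcs to 0 are nested. If neither of the first two alternatives holds, the distances
to 0 strictly decrease along `a, b, c`, so `b` is between `a` and `c`. -/
theorem cycBetween_of_same_side {s a b c : ℕ} (ha : a < s) (hb : b < s) (hc : c < s)
    (side : (2 * a ≤ s ∧ 2 * b ≤ s ∧ 2 * c ≤ s) ∨ (s < 2 * a ∧ s < 2 * b ∧ s < 2 * c)) :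
    CycBetween s 0 a b ∨ CycBetween s 0 b c ∨ CycBetween s a b c := by
  have d : ∀ x y : ℕ, Nat.dist x y = x - y + (y - x) := fun _ _ => rfl
  unfold CycBetween
  rw [cycDist_of_two_mul_le (a := a) (b := b) (by rw [d]; omega),
    cycDist_of_two_mul_le (a := a) (b := c) (by rw [d]; omega),
    cycDist_of_two_mul_le (a := b) (b := c) (by rw [d]; omega), d, d, d]
  rcases side with ⟨h₁, h₂, h₃⟩ | ⟨h₁, h₂, h₃⟩
  · rw [cycDist_zero_of_le h₁, cycDist_zero_of_le h₂, cycDist_zero_of_le h₃]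
    omega
  · rw [cycDist_zero_of_ge h₁.le, cycDist_zero_of_ge h₂.le, cycDist_zero_of_ge h₃.le]
    omega

theorem exists_monochromatic_triple :
    ∀ g : Fin 5 → Bool, ∃ i j k : Fin 5, i < j ∧ j < k ∧ g i = g j ∧ g j = g k := by
  decide

theorem not_noCycMonotone_six {s : ℕ} {y : Fin 6 → ℕ} (hy : ∀ i, y i < s) :
    ¬ NoCycMonotone s y := by
  intro h
  have h' := h.cycShift (hy 0) hy
  have hz : ∀ i, cycShift s (y 0) (y i) < s := fun i => cycShift_lt (hy 0) (hy i)
  have h0 := cycShift_self s (y 0)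
  generalize cycShift s (y 0) = p at h' hz h0
  obtain ⟨i, j, k, hij, hjk, e₁, e₂⟩ :=
    exists_monochromatic_triple fun i => decide (2 * p (y i.succ) ≤ s)
  simp only [decide_eq_decide] at e₁ e₂
  have := cycBetween_of_same_side (hz i.succ) (hz j.succ) (hz k.succ) (by omega)
  rw [← h0] at this
  rcases this with h | h | h
  · exact h' 0 i.succ j.succ (Fin.succ_pos _) (Fin.succ_lt_succ_iff.2 hij) h
  · exact h' 0 j.succ k.succ (Fin.succ_pos _) (Fin.succ_lt_succ_iff.2 hjk) h
  · exact h' i.succ j.succ k.succ (Fin.succ_lt_succ_iff.2 hij) (Fin.succ_lt_succ_iff.2 hjk) h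

set_option synthInstance.maxHeartbeats 400000 in
set_option synthInstance.maxSize 2000 in
-- The nested disjunctions prune the search: a prefix is extended only if it has no forbidden
-- triple.
theorem exists_cycBetween_of_small {s : ℕ} (hs : s ≤ 6 ∨ s = 8) :
    ∀ a < s, ∀ b < s, CycBetween s 0 a b ∨ ∀ c < s,
      (CycBetween s 0 a c ∨ CycBetween s 0 b c ∨ CycBetween s a b c) ∨ ∀ d < s,
      CycBetween s 0 a d ∨ CycBetween s 0 b d ∨ CycBetween s 0 c d ∨ CycBetween s a b d ∨
        CycBetween s a c d ∨ CycBetween s b c d := by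
  obtain rfl | rfl | rfl | rfl | rfl | rfl | rfl | rfl :
    s = 0 ∨ s = 1 ∨ s = 2 ∨ s = 3 ∨ s = 4 ∨ s = 5 ∨ s = 6 ∨ s = 8 := by omega
  all_goals decide +kernel

theorem not_noCycMonotone_five_of_small {s : ℕ} (hs : s ≤ 6 ∨ s = 8) {y : Fin 5 → ℕ}
    (hy : ∀ i, y i < s) : ¬ NoCycMonotone s y := by
  intro h
  have h' := h.cycShift (hy 0) hy
  have hz : ∀ i, cycShift s (y 0) (y i) < s := fun i => cycShift_lt (hy 0) (hy i)
  have h0 := cycShift_self s (y 0)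
  generalize cycShift s (y 0) = p at h' hz h0
  have key := exists_cycBetween_of_small hs _ (hz 1) _ (hz 2)
  rw [← h0] at key
  rcases key with h | key
  · exact h' 0 1 2 (by decide) (by decide) h
  rcases key _ (hz 3) with (h | h | h) | key
  · exact h' 0 1 3 (by decide) (by decide) h
  · exact h' 0 2 3 (by decide) (by decide) h
  · exact h' 1 2 3 (by decide) (by decide) h
  rcases key _ (hz 4) with h | h | h | h | h | h
  · exact h' 0 1 4 (by decide) (by decide) h
  · exact h' 0 2 4 (by decide) (by decide) h
  · exact h' 0 3 4 (by decide) (by decide) h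
  · exact h' 1 2 4 (by decide) (by decide) h
  · exact h' 1 3 4 (by decide) (by decide) h
  · exact h' 2 3 4 (by decide) (by decide) h

/-! ### Five points have distinct path coordinates -/

/-- With 0 and `q` the tied residues, any other residue is strictly inside the arc from 0 to `q` or
strictly inside its antipodal image. -/
theorem mem_arcs_of_not_cycBetween {s q u : ℕ} (hq : 2 * q ≤ s) (hu : u < s)
    (h₁ : ¬ CycBetween s u 0 q) (h₂ : ¬ CycBetween s u q 0) :
    (0 < u ∧ u < q) ∨ (q ≤ u ∧ s < 2 * u ∧ 2 * u < s + 2 * q) := by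
  simp only [CycBetween, cycDist, Nat.dist] at h₁ h₂
  omega

/-- Within one arc, going from `u` to `v` also heads towards 0 or towards `q`. -/
theorem lt_iff_not_lt_of_before {s q u v : ℕ} (hq : 2 * q ≤ s)
    (hu : (0 < u ∧ u < q) ∨ (q ≤ u ∧ s < 2 * u ∧ 2 * u < s + 2 * q))
    (hv : (0 < v ∧ v < q) ∨ (q ≤ v ∧ s < 2 * v ∧ 2 * v < s + 2 * q))
    (us : u < s) (vs : v < s)
    (h₁ : ¬ CycBetween s u v 0) (h₂ : ¬ CycBetween s u v q) : ¬ (u < q ↔ v < q) := by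
  intro h
  have d : ∀ x y : ℕ, Nat.dist x y = x - y + (y - x) := fun _ _ => rfl
  unfold CycBetween at h₁ h₂
  rw [cycDist_comm s u 0, cycDist_comm s v 0,
    cycDist_of_two_mul_le (a := u) (b := v) (by rw [d]; omega)] at h₁
  rw [cycDist_of_two_mul_le (a := u) (b := v) (by rw [d]; omega),
    cycDist_of_two_mul_le (a := u) (b := q) (by rw [d]; omega),
    cycDist_of_two_mul_le (a := v) (b := q) (by rw [d]; omega)] at h₂
  rw [d] at h₁
  rw [d, d, d] at h₂
  by_cases huq : u < q
  · rw [cycDist_zero_of_le (by omega), cycDist_zero_of_le (by omega)] at h₁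
    omega
  · rw [cycDist_zero_of_ge (by omega), cycDist_zero_of_ge (by omega)] at h₁
    omega

/-- A shortest path from `u` to the antipodal arc must leave through an endpoint, 0 or `q`. -/
theorem cycBetween_of_across {s q u v : ℕ} (hq : 2 * q ≤ s)
    (hu : 0 < u ∧ u < q)
    (hv : q ≤ v ∧ s < 2 * v ∧ 2 * v < s + 2 * q) (vs : v < s) :
    CycBetween s u 0 v ∨ CycBetween s u q v := by
  have d : ∀ x y : ℕ, Nat.dist x y = x - y + (y - x) := fun _ _ => rfl
  unfold CycBetween
  rw [cycDist_comm s u 0, cycDist_zero_of_le (by omega), cycDist_zero_of_ge (a := v) (by omega),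
    cycDist_of_two_mul_le (a := q) (b := v) (by rw [d]; omega),
    cycDist_of_two_mul_le (a := u) (b := q) (by rw [d]; omega), cycDist, d, d, d]
  omega

/-- Parity: among three points, an even number of pairs is separated by the tie, but an odd number
of pairs shares a colour. -/
theorem exists_pair_of_two_coloring :
    ∀ (i : Fin 4) (g : Fin 5 → Bool), ∃ j k : Fin 5, j < k ∧ j ≠ i.castSucc ∧ j ≠ i.succ ∧
      k ≠ i.castSucc ∧ k ≠ i.succ ∧ ¬ ((j < i.castSucc ∧ i.castSucc < k) ↔ g j = g k) := by
  decide +kernel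

/-- The points `(x i, y i)` of a cylinder of circumference `s` are in general position. -/
def CylinderGeneralPosition (s : ℕ) {n : ℕ} (x y : Fin n → ℕ) : Prop :=
  ∀ i j k, i ≠ j → i ≠ k → j ≠ k → x i ≤ x j → x j ≤ x k → ¬ CycBetween s (y i) (y j) (y k)

namespace CylinderGeneralPosition

variable {s n : ℕ}

theorem noCycMonotone {x y : Fin n → ℕ} (h : CylinderGeneralPosition s x y) (hx : Monotone x) :
    NoCycMonotone s y := fun i j k hij hjk =>
  h i j k hij.ne (hij.trans hjk).ne hjk.ne (hx hij.le) (hx hjk.le)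

theorem cycShift {x y : Fin n → ℕ} (h : CylinderGeneralPosition s x y) {a : ℕ} (ha : a < s)
    (hy : ∀ i, y i < s) : CylinderGeneralPosition s x fun i => cycShift s a (y i) := by
  intro i j k h₁ h₂ h₃ h₄ h₅
  simp only [CycBetween, cycDist_cycShift, ha, hy]
  exact h i j k h₁ h₂ h₃ h₄ h₅

theorem not_side_iff_of_tie {x z : Fin 5 → ℕ} (h : CylinderGeneralPosition s x z) (hx : Monotone x)
    (hz : ∀ i, z i < s) {p q : Fin 5} (hpq : p ≠ q) (tie : x p = x q) (hp : z p = 0)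
    (hq : 2 * z q ≤ s) {j k : Fin 5} (hjk : j < k) (jp : j ≠ p) (jq : j ≠ q) (kp : k ≠ p)
    (kq : k ≠ q) (same : (j < p ↔ j < q) ∧ (k < p ↔ k < q)) :
    (j < p ∧ p < k) ↔ (z j < z q ↔ z k < z q) := by
  have arcs : ∀ m, m ≠ p → m ≠ q →
      (0 < z m ∧ z m < z q) ∨ (z q ≤ z m ∧ s < 2 * z m ∧ 2 * z m < s + 2 * z q) := by
    intro m mp mq
    rcases le_total (x m) (x p) with hm | hm
    · refine mem_arcs_of_not_cycBetween hq (hz m) ?_ ?_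
      · rw [← hp]
        exact h m p q mp mq hpq hm tie.le
      · rw [← hp]
        exact h m q p mq mp hpq.symm (hm.trans tie.le) tie.ge
    · refine mem_arcs_of_not_cycBetween hq (hz m) ?_ ?_
      · have := h q p m hpq.symm mq.symm mp.symm tie.ge hm
        rwa [hp, CycBetween, cycDist_comm, add_comm, cycDist_comm s 0, cycDist_comm s (z q)] at this
      · have := h p q m hpq mp.symm mq.symm tie.le (tie.ge.trans hm)
        rwa [hp, CycBetween, cycDist_comm, add_comm, cycDist_comm s 0, cycDist_comm s (z q)] at this
  have aj := arcs j jp jq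
  have ak := arcs k kp kq
  rcases lt_or_gt_of_ne jp with hj | hj
  · rcases lt_or_gt_of_ne kp with hk | hk
    · have h₁ := h j k p hjk.ne jp kp (hx hjk.le) (hx hk.le)
      have h₂ := h j k q hjk.ne jq kq (hx hjk.le) (hx (same.2.1 hk).le)
      rw [hp] at h₁
      have := lt_iff_not_lt_of_before hq aj ak (hz j) (hz k) h₁ h₂
      exact iff_of_false (fun h => hk.asymm h.2) this
    · have hqk : q < k := lt_of_le_of_ne (not_lt.1 fun h => hk.asymm (same.2.2 h)) kq.symm
      have h₁ := h j p k jp hjk.ne kp.symm (hx hj.le) (hx hk.le)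
      have h₂ := h j q k jq hjk.ne kq.symm (hx (same.1.1 hj).le) (hx hqk.le)
      rw [hp] at h₁
      refine iff_of_true ⟨hj, hk⟩ ?_
      rcases aj with aj | aj <;> rcases ak with ak | ak
      · exact iff_of_true aj.2 ak.2
      · exact absurd (cycBetween_of_across hq aj ak (hz k)) (not_or.2 ⟨h₁, h₂⟩)
      · refine absurd (cycBetween_of_across hq ak aj (hz j)) (not_or.2 ⟨?_, ?_⟩)
        · rwa [CycBetween, cycDist_comm, add_comm, cycDist_comm s 0, cycDist_comm s (z k)]
        · rwa [CycBetween, cycDist_comm, add_comm, cycDist_comm s (z q), cycDist_comm s (z k)]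
      · exact iff_of_false aj.1.not_gt ak.1.not_gt
  · have hqj : q < j := lt_of_le_of_ne (not_lt.1 fun h => hj.asymm (same.1.2 h)) jq.symm
    have h₁ := h p j k jp.symm kp.symm hjk.ne (hx hj.le) (hx hjk.le)
    have h₂ := h q j k jq.symm kq.symm hjk.ne (hx hqj.le) (hx hjk.le)
    rw [hp, CycBetween, cycDist_comm, add_comm, cycDist_comm s 0, cycDist_comm s (z j)] at h₁
    rw [CycBetween, cycDist_comm, add_comm, cycDist_comm s (z q), cycDist_comm s (z j)] at h₂
    have := lt_iff_not_lt_of_before hq ak aj (hz k) (hz j) h₁ h₂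
    exact iff_of_false (fun h => hj.asymm h.1) fun h => this h.symm

theorem ne_of_tie {x y : Fin 5 → ℕ} (h : CylinderGeneralPosition s x y) (hx : Monotone x)
    (hy : ∀ i, y i < s) (i : Fin 4) : x i.castSucc ≠ x i.succ := by
  intro tie
  have main : ∀ p q : Fin 5, (p = i.castSucc ∧ q = i.succ) ∨ (p = i.succ ∧ q = i.castSucc) →
      s < 2 * _root_.cycShift s (y p) (y q) := by
    intro p q hpq
    by_contra! hs
    obtain ⟨j, k, hjk, j₁, j₂, k₁, k₂, hg⟩ := exists_pair_of_two_coloring i fun m =>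
      decide (_root_.cycShift s (y p) (y m) < _root_.cycShift s (y p) (y q))
    refine hg ?_
    rw [decide_eq_decide]
    have key : (j < p ∧ p < k) ↔ _ :=
      not_side_iff_of_tie (h.cycShift (hy p) hy) hx (fun m => cycShift_lt (hy p) (hy m))
        (p := p) (q := q) ?_ ?_ (cycShift_self _ _) hs hjk ?_ ?_ ?_ ?_ ?_
    · rw [← key]
      rcases hpq with ⟨rfl, rfl⟩ | ⟨rfl, rfl⟩ <;>
        (simp only [Fin.lt_def, Fin.ext_iff, ne_eq, Fin.val_castSucc, Fin.val_succ] at * <;> omega)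
    all_goals
      rcases hpq with ⟨rfl, rfl⟩ | ⟨rfl, rfl⟩ <;> first | assumption | exact tie.symm | skip
    all_goals
      simp only [Fin.lt_def, Fin.ext_iff, ne_eq, Fin.val_castSucc, Fin.val_succ] at *
      omega
  -- The two rotations give offsets that sum to `s` or are both 0, so they cannot both exceed `s /
  -- 2`.
  have h₁ := main _ _ (.inl ⟨rfl, rfl⟩)
  have h₂ := main _ _ (.inr ⟨rfl, rfl⟩)
  have hy₁ := hy i.castSucc
  have hy₂ := hy i.succ
  unfold _root_.cycShift at h₁ h₂
  split_ifs at h₁ h₂ <;> omega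

theorem five_le_of_five {r : ℕ} {x y : Fin 5 → ℕ} (h : CylinderGeneralPosition s x y)
    (hx : Monotone x) (hr : ∀ i, x i < r) (hy : ∀ i, y i < s) : 5 ≤ r := by
  have step : ∀ i : Fin 4, x i.castSucc < x i.succ := fun i =>
    lt_of_le_of_ne (hx (Fin.castSucc_lt_succ).le) (h.ne_of_tie hx hy i)
  have h₀ : x 0 < x 1 := step 0
  have h₁ : x 1 < x 2 := step 1
  have h₂ : x 2 < x 3 := step 2
  have h₃ : x 3 < x 4 := step 3
  have := hr 4
  omega

end CylinderGeneralPosition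

/-! ### From vertex sets to sorted coordinates -/

theorem natDist_add_eq {a b c : ℕ} (h : a ≤ b) (h' : b ≤ c) :
    Nat.dist a c = Nat.dist a b + Nat.dist b c := by
  simp only [Nat.dist]
  omega

theorem cycDist_triangle {s a b c : ℕ} (ha : a < s) (hb : b < s) (hc : c < s) :
    cycDist s a c ≤ cycDist s a b + cycDist s b c := by
  simp only [cycDist, Nat.dist]
  omega

/-- Equality in the summed triangle inequality forces it in each factor; on the path it means
monotone order, up to reversing the triple. -/
theorem isGeneralPosition_range_iff {r s n : ℕ} (hs : 2 ≤ s) {f : Fin n → Fin r × Fin s}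
    (hf : Function.Injective f) :
    (cylinderGraph r s).IsGeneralPosition (Set.range f) ↔
      CylinderGeneralPosition s (fun i => ((f i).1 : ℕ)) fun i => ((f i).2 : ℕ) := by
  constructor
  · intro h i j k hij hik hjk h₁ h₂ hb
    refine h ⟨i, rfl⟩ ⟨k, rfl⟩ ⟨j, rfl⟩ (hf.ne hik) (hf.ne hij) (hf.ne hjk.symm) ?_
    have hd := natDist_add_eq h₁ h₂
    rw [cylinderGraph_dist hs, cylinderGraph_dist hs, cylinderGraph_dist hs]
    simp only [CycBetween] at hb hd
    omega
  · rintro h _ ⟨i, rfl⟩ _ ⟨k, rfl⟩ _ ⟨j, rfl⟩ hik hij hkj hd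
    have hik : i ≠ k := fun e => hik (congrArg f e)
    have hij : i ≠ j := fun e => hij (congrArg f e)
    have hjk : j ≠ k := fun e => hkj (congrArg f e.symm)
    rw [cylinderGraph_dist hs, cylinderGraph_dist hs, cylinderGraph_dist hs] at hd
    have h₁ := cycDist_triangle (f i).2.isLt (f j).2.isLt (f k).2.isLt
    have h₂ := Nat.dist.triangle_inequality (f i).1 (f j).1 (f k).1
    have hb : CycBetween s (f i).2 (f j).2 (f k).2 := by
      unfold CycBetween
      omega
    have hx : Nat.dist (f i).1 (f k).1 = Nat.dist (f i).1 (f j).1 + Nat.dist (f j).1 (f k).1 := by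
      omega
    simp only [Nat.dist] at hx
    by_cases hle : ((f i).1 : ℕ) ≤ (f j).1 ∧ ((f j).1 : ℕ) ≤ (f k).1
    · exact h i j k hij hik hjk hle.1 hle.2 hb
    · refine h k j i hjk.symm hik.symm hij.symm ?_ ?_ ?_
      · simp only
        omega
      · simp only
        omega
      · rw [CycBetween, cycDist_comm, add_comm] at hb
        rwa [CycBetween, cycDist_comm s (f k).2 (f j).2, cycDist_comm s (f j).2 (f i).2]

theorem exists_sorted_enumeration {r s n : ℕ} {S : Finset (Fin r × Fin s)} (hS : S.card = n) :
    ∃ f : Fin n → Fin r × Fin s, Function.Injective f ∧ Set.range f = S ∧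
      Monotone fun i => ((f i).1 : ℕ) := by
  have hc : (S.map (toLex (α := Fin r × Fin s)).toEmbedding).card = n := by simpa using hS
  have hmono := (Finset.orderEmbOfFin _ hc).monotone
  refine ⟨fun i => ofLex (Finset.orderEmbOfFin _ hc i), ?_, ?_, ?_⟩
  · exact ofLex.injective.comp (Finset.orderEmbOfFin _ hc).injective
  · change Set.range (ofLex ∘ (Finset.orderEmbOfFin _ hc)) = _
    rw [Set.range_comp, Finset.range_orderEmbOfFin]
    ext a
    simp
  · intro i j hij
    have h := hmono hij
    rw [Prod.Lex.le_iff] at h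
    rcases h with h | h
    · exact h.le
    · exact h.1.le

namespace SimpleGraph

theorem IsGeneralPosition.mono {V : Type*} {G : SimpleGraph V} {S T : Set V} (h : G.IsGeneralPosition T)
    (hST : S ⊆ T) :
    G.IsGeneralPosition S := fun _ hu _ hv _ hw => h (hST hu) (hST hv) (hST hw)

theorem gpNumber_le {V : Type*} [Fintype V] {G : SimpleGraph V} {n : ℕ}
    (h : ∀ S : Finset V, S.card = n + 1 → ¬ G.IsGeneralPosition (S : Set V)) : G.gpNumber ≤ n := by
  classical
  refine Finset.sup_le fun S hS => ?_
  by_contra! hn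
  obtain ⟨T, hTS, hT⟩ := Finset.exists_subset_card_eq (Nat.succ_le_of_lt hn)
  exact h T hT (IsGeneralPosition.mono (Finset.mem_filter.1 hS).2 (by exact_mod_cast hTS))

theorem le_gpNumber {V : Type*} [Fintype V] {G : SimpleGraph V} {n : ℕ} {f : Fin n → V}
    (hf : Function.Injective f)
    (h : G.IsGeneralPosition (Set.range f)) : n ≤ G.gpNumber := by
  classical
  unfold gpNumber
  have h' : G.IsGeneralPosition ((Finset.univ.map ⟨f, hf⟩ : Finset V) : Set V) := by simpa using h
  refine le_trans (le_of_eq ?_)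
    (Finset.le_sup (b := Finset.univ.map ⟨f, hf⟩) (Finset.mem_filter.2 ⟨Finset.mem_univ _, h'⟩))
  simp

end SimpleGraph

theorem gpNumber_cylinderGraph_le {r s n : ℕ} (hs : 2 ≤ s)
    (h : ∀ x y : Fin (n + 1) → ℕ, Monotone x → (∀ i, x i < r) → (∀ i, y i < s) →
      (∀ i j, x i = x j → y i = y j → i = j) → ¬ CylinderGeneralPosition s x y) :
    (cylinderGraph r s).gpNumber ≤ n := by
  refine SimpleGraph.gpNumber_le fun S hS hgp => ?_
  obtain ⟨f, hf, hr, hx⟩ := exists_sorted_enumeration hS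
  rw [← hr, isGeneralPosition_range_iff hs hf] at hgp
  exact h _ _ hx (fun i => (f i).1.isLt) (fun i => (f i).2.isLt)
    (fun i j h₁ h₂ => hf (Prod.ext (Fin.ext h₁) (Fin.ext h₂))) hgp

theorem le_gpNumber_cylinderGraph {r s n : ℕ} (hs : 2 ≤ s) {x y : Fin n → ℕ} (hx : ∀ i, x i < r)
    (hy : ∀ i, y i < s) (inj : ∀ i j, x i = x j → y i = y j → i = j)
    (h : CylinderGeneralPosition s x y) : n ≤ (cylinderGraph r s).gpNumber := by
  have hf : Function.Injective fun i => ((⟨x i, hx i⟩, ⟨y i, hy i⟩) : Fin r × Fin s) := by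
    intro i j hij
    simp only [Prod.mk.injEq, Fin.mk.injEq] at hij
    exact inj i j hij.1 hij.2
  exact SimpleGraph.le_gpNumber hf ((isGeneralPosition_range_iff hs hf).2 h)

theorem cylinderGeneralPosition_id_iff {s n : ℕ} {y : Fin n → ℕ} :
    CylinderGeneralPosition s (fun i => (i : ℕ)) y ↔ NoCycMonotone s y := by
  refine ⟨fun h => h.noCycMonotone Fin.val_strictMono.monotone, fun h i j k hij _ hjk h₁ h₂ => ?_⟩
  exact h i j k (lt_of_le_of_ne h₁ hij) (lt_of_le_of_ne h₂ hjk)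

/-! ### The case of the prism and the explicit configurations -/

theorem cycBetween_self_left (s a b : ℕ) : CycBetween s a a b := by
  simp [CycBetween, cycDist]

theorem not_cylinderGeneralPosition_two_three {x y : Fin 4 → ℕ} (hr : ∀ i, x i < 2)
    (hy : ∀ i, y i < 3) (inj : ∀ i j, x i = x j → y i = y j → i = j) :
    ¬ CylinderGeneralPosition 3 x y := by
  intro h
  obtain ⟨i, j, hij, he⟩ := Fintype.exists_ne_map_eq_of_card_lt
    (fun i => (⟨y i, hy i⟩ : Fin 3)) (by simp)
  rw [Fin.mk.injEq] at he
  wlog hlt : x i < x j generalizing i j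
  · refine this j i hij.symm he.symm (lt_of_le_of_ne (not_lt.1 hlt) fun e => ?_)
    exact hij (inj i j e.symm he)
  have third : ∀ i j : Fin 4, ∃ k, i ≠ k ∧ j ≠ k := by decide
  obtain ⟨k, hik, hjk⟩ := third i j
  have hxj := hr j
  have hxk := hr k
  -- Of `i` and `j`, which share a residue, the one in the layer of `k` is between `k` and the
  -- other.
  by_cases hk : x k = 0
  · refine h k i j hik.symm hjk.symm hij (by omega) hlt.le ?_
    rw [he, CycBetween, add_comm, cycDist_comm 3 (y k)]
    have := cycBetween_self_left 3 (y j) (y k)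
    rwa [CycBetween] at this
  · refine h i j k hij hik hjk hlt.le (by omega) ?_
    rw [he]
    exact cycBetween_self_left 3 _ _

theorem four_le_gpNumber_three {r : ℕ} (hr : 3 ≤ r) : 4 ≤ (cylinderGraph r 3).gpNumber := by
  refine le_gpNumber_cylinderGraph (x := ![0, 1, 1, 2]) (y := ![0, 1, 2, 0]) (by omega) ?_
    (by decide) (by decide) ?_
  · intro i
    refine lt_of_lt_of_le ?_ hr
    revert i
    decide
  · unfold CylinderGeneralPosition
    decide +kernel

theorem three_le_gpNumber_two_three : 3 ≤ (cylinderGraph 2 3).gpNumber := by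
  refine le_gpNumber_cylinderGraph (x := ![0, 0, 1]) (y := ![0, 1, 2]) (by omega)
    (by decide) (by decide) (by decide) ?_
  unfold CylinderGeneralPosition
  decide +kernel

theorem four_le_gpNumber {r s : ℕ} (hr : 2 ≤ r) (hs : 4 ≤ s) :
    4 ≤ (cylinderGraph r s).gpNumber := by
  -- A nearly antipodal pair in one layer, and its rotation by one in the next.
  refine le_gpNumber_cylinderGraph (x := ![0, 0, 1, 1]) (y := ![0, s / 2, 1, s / 2 + 1])
    (by omega) ?_ ?_ ?_ ?_
  · simp [Fin.forall_fin_succ]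
    omega
  · simp [Fin.forall_fin_succ]
    omega
  · simp [Fin.forall_fin_succ]
    omega
  · simp [CylinderGeneralPosition, Fin.forall_fin_succ, CycBetween, cycDist, Nat.dist]
    omega

theorem five_le_gpNumber_of_noCycMonotone {r s : ℕ} (hr : 5 ≤ r) (hs : 2 ≤ s) {y : Fin 5 → ℕ}
    (hy : ∀ i, y i < s) (h : NoCycMonotone s y) : 5 ≤ (cylinderGraph r s).gpNumber :=
  le_gpNumber_cylinderGraph hs (x := fun i => i) (fun i => i.isLt.trans_le hr) hy
    (fun _ _ hij _ => Fin.ext hij) (cylinderGeneralPosition_id_iff.2 h)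

theorem noCycMonotone_odd {k : ℕ} (hk : 3 ≤ k) :
    NoCycMonotone (2 * k + 1) ![0, 2, k + 1, k + 3, 1] := by
  simp [NoCycMonotone, Fin.forall_fin_succ, CycBetween, cycDist, Nat.dist]
  omega

/-- Two nearly antipodal pairs, and a last residue between the first two. The entry `k + 4` is a
residue below `2 * k` only for `k ≥ 5`, so this misses `s = 8`. -/
theorem noCycMonotone_even {k : ℕ} (hk : 5 ≤ k) :
    NoCycMonotone (2 * k) ![0, 3, k + 1, k + 4, 2] := by
  simp [NoCycMonotone, Fin.forall_fin_succ, CycBetween, cycDist, Nat.dist]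
  omega

theorem five_le_gpNumber {r s : ℕ} (hr : 5 ≤ r) (hs : s = 7 ∨ 9 ≤ s) :
    5 ≤ (cylinderGraph r s).gpNumber := by
  obtain ⟨k, rfl | rfl⟩ := Nat.even_or_odd' s
  · refine five_le_gpNumber_of_noCycMonotone hr (by omega) ?_ (noCycMonotone_even (by omega))
    simp [Fin.forall_fin_succ]
    omega
  · refine five_le_gpNumber_of_noCycMonotone hr (by omega) ?_ (noCycMonotone_odd (by omega))
    simp [Fin.forall_fin_succ]
    omega

theorem theorem3p2 (r s : ℕ) (hr : 2 ≤ r) (hs : 3 ≤ s) :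
    (cylinderGraph r s).gpNumber =
      if r = 2 ∧ s = 3 then 3
      else if 5 ≤ r ∧ (s = 7 ∨ 9 ≤ s) then 5
      else 4 := by
  split_ifs with h₁ h₂
  · obtain ⟨rfl, rfl⟩ := h₁
    exact le_antisymm (gpNumber_cylinderGraph_le (by omega) fun _ _ _ hr hy inj =>
      not_cylinderGeneralPosition_two_three hr hy inj) three_le_gpNumber_two_three
  · exact le_antisymm (gpNumber_cylinderGraph_le (by omega) fun _ _ hx _ hy _ h =>
      not_noCycMonotone_six hy (h.noCycMonotone hx)) (five_le_gpNumber h₂.1 h₂.2)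
  · refine le_antisymm (gpNumber_cylinderGraph_le (by omega) fun x y hx hr hy _ h => ?_) ?_
    · have := h.five_le_of_five hx hr hy
      exact not_noCycMonotone_five_of_small (by omega) hy (h.noCycMonotone hx)
    · by_cases h3 : s = 3
      · subst h3
        exact four_le_gpNumber_three (by omega)
      · exact four_le_gpNumber hr (by omega)
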